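/- For complex $z$ with $|z|\le 1$ let $\operatorname{Li}_2(z)=\sum_{n\ge 1} z^n/n^2$ be the dilogarithm, let $\zeta$ be the Riemann zeta function, and let $\log$ be the natural logarithm. Let $$r=\frac{-1+\sqrt{33}-\sqrt{2(9-\sqrt{33})}}{4},\qquad r_2=\frac{1+\sqrt{33}-\sqrt{2(9+\sqrt{33})}}{4}.$$ Then $0<r_2<r<1$, and the positive real solutions $x$ of $$(x^4-x^3-6x^2-x+1)(x^4+x^3-6x^2+x+1)=0$$ are exactly the four numbers $r,\ r_2,\ r^{-1},\ r_2^{-1}$. Moreover, $$3\operatorname{Li}_2(r^6)+3\operatorname{Li}_2(r^4)-8\operatorname{Li}_2(r^3)-33\operatorname{Li}_2(r^2)+24\operatorname{Li}_2(r)-\zeta(2)=6\log^2 r$$ and $$\operatorname{Li}_2(r_2^6)-3\operatorname{Li}_2(r_2^4)-8\operatorname{Li}_2(r_2^3)+21\operatorname{Li}_2(r_2^2)+24\operatorname{Li}_2(r_2)-11\zeta(2)=-6\log^2 r_2.$$ -/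

import Mathlib

/-- The polylogarithm `Li_m(z) = ∑_{n ≥ 1} z ^ n / n ^ m`, for complex `z` with `‖z‖ ≤ 1`
(only `m ≥ 2` is used, where the series converges absolutely on the closed unit disc). -/
noncomputable def polylog (m : ℕ) (z : ℂ) : ℂ :=
  ∑' n : ℕ, z ^ (n + 1) / ((n + 1 : ℕ) : ℂ) ^ m

/-- The dilogarithm `Li₂`. -/
noncomputable def Li₂ (z : ℂ) : ℂ := polylog 2 z

/-- The series defining `polylog m z` converges for `m ≥ 2` and `‖z‖ ≤ 1`. -/
theorem summable_polylog {m : ℕ} (hm : 2 ≤ m) {z : ℂ} (hz : ‖z‖ ≤ 1) :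
    Summable fun n : ℕ => z ^ (n + 1) / ((n + 1 : ℕ) : ℂ) ^ m := by
  have h : Summable fun n : ℕ => 1 / ((n : ℝ)) ^ m :=
    Real.summable_one_div_nat_pow.2 (by omega)
  refine Summable.of_norm_bounded ((summable_nat_add_iff 1).2 h) fun n => ?_
  rw [norm_div, norm_pow, norm_pow, Complex.norm_natCast]
  gcongr
  exact pow_le_one₀ (norm_nonneg _) hz

/-! Adding half of log x log(1 - x) to the dilogarithm gives the Rogers function L, whose functional
equations carry no logarithmic terms: reflection and the five-term relation (`rogersL_one_sub`,
`rogersL_five_term`). Each is proved by checking that a derivative vanishes and evaluating at 0.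

For a ladder with coefficients c_n, the product of (1 - r^n)^(n c_n) is a power of r. Hence the sum
of c_n r^n ∧ (1 - r^n) is zero and the ladder defines an element of the Bloch group of a field
generated by a root of x^4 + x^3 - 6x^2 + x + 1; both r and -r₂ are such roots. All four roots are
real, so the class is torsion and the L-value must be a rational multiple of π². The proof makes
this explicit: `rogersL_ladder_r` and `rogersL_ladder_r₂` write each ladder as a finite integer
combination of five-term and reflection relations. The same power-of-r identity then turns the
logarithmic corrections into a multiple of log² r. -/

/-! ### The real dilogarithm and the Rogers function: continuity and derivatives. -/

/-- The dilogarithm series at a real argument. -/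
noncomputable def realDilog (x : ℝ) : ℝ :=
  ∑' n : ℕ, x ^ (n + 1) / ((n + 1 : ℕ) : ℝ) ^ 2

/-- The Rogers dilogarithm on `[0, 1]`. -/
noncomputable def rogersL (x : ℝ) : ℝ :=
  realDilog x + Real.log x * Real.log (1 - x) / 2

theorem Li₂_ofReal (x : ℝ) : Li₂ (x : ℂ) = (realDilog x : ℂ) := by
  simp [Li₂, polylog, realDilog, Complex.ofReal_tsum]

theorem summable_one_div_succ_sq : Summable fun n : ℕ => 1 / ((n + 1 : ℕ) : ℝ) ^ 2 :=
  (summable_nat_add_iff 1).2 (Real.summable_one_div_nat_pow.2 one_lt_two)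

theorem continuousOn_realDilog : ContinuousOn realDilog (Set.Icc 0 1) := by
  refine continuousOn_tsum (fun n => by fun_prop) summable_one_div_succ_sq fun n x hx => ?_
  rw [Real.norm_of_nonneg (div_nonneg (pow_nonneg hx.1 _) (by positivity))]
  gcongr
  exact pow_le_one₀ hx.1 hx.2

theorem realDilog_zero : realDilog 0 = 0 := by
  simp [realDilog]

theorem realDilog_one : realDilog 1 = Real.pi ^ 2 / 6 := by
  -- The zeta sum starts at n = 0 with 1/0² = 0, so the shift subtracts nothing.
  have h := (hasSum_nat_add_iff' 1).2 hasSum_zeta_two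
  simpa [realDilog] using h.tsum_eq

theorem hasDerivAt_realDilog {x : ℝ} (h0 : 0 < x) (h1 : x < 1) :
    HasDerivAt realDilog (-Real.log (1 - x) / x) x := by
  -- On (-ρ, ρ) the differentiated terms are dominated by ρ^n, which permits termwise
  -- differentiation; convergence of the series itself is only needed at 0.
  obtain ⟨ρ, hxρ, hρ⟩ := exists_between h1
  have hρ0 : 0 < ρ := h0.trans hxρ
  have hterm : ∀ (n : ℕ) (y : ℝ), HasDerivAt (fun y : ℝ => y ^ (n + 1) / ((n + 1 : ℕ) : ℝ) ^ 2)
      (y ^ n / ((n : ℝ) + 1)) y := fun n y => by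
    refine ((hasDerivAt_pow (n + 1) y).div_const _).congr_deriv ?_
    push_cast
    field_simp
  have hbound : ∀ (n : ℕ) (y : ℝ), y ∈ Set.Ioo (-ρ) ρ → ‖y ^ n / ((n : ℝ) + 1)‖ ≤ ρ ^ n :=
    fun n y hy => by
      rw [norm_div, norm_pow, Real.norm_eq_abs, Real.norm_of_nonneg (by positivity)]
      refine (div_le_self (by positivity) (by linarith [n.cast_nonneg (α := ℝ)])).trans ?_
      gcongr
      exact (abs_lt.2 hy).le
  have h := hasDerivAt_tsum_of_isPreconnected (summable_geometric_of_lt_one hρ0.le hρ) isOpen_Ioo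
    isPreconnected_Ioo (fun n y _ => hterm n y) hbound
    (show (0 : ℝ) ∈ Set.Ioo (-ρ) ρ by constructor <;> linarith) (by simp)
    (show x ∈ Set.Ioo (-ρ) ρ by constructor <;> linarith)
  refine h.congr_deriv ?_
  rw [eq_div_iff h0.ne', ← tsum_mul_right,
    ← (Real.hasSum_pow_div_log_of_abs_lt_one (abs_lt.2 ⟨by linarith, h1⟩)).tsum_eq]
  exact tsum_congr fun n => by ring

/-- Near 0, log(1 - x) = O(x) and x log x → 0; the limit agrees with the value because log 0 = 0 by
convention. -/
theorem continuousAt_log_mul_log_one_sub_zero :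
    ContinuousAt (fun x : ℝ => Real.log x * Real.log (1 - x)) 0 := by
  have hd : HasDerivAt (fun x : ℝ => Real.log (1 - x)) (-1) 0 := by
    simpa using ((hasDerivAt_id (0 : ℝ)).const_sub 1).log (by simp)
  have hO : (fun x : ℝ => Real.log (1 - x)) =O[nhds 0] fun x => x := by
    simpa using hd.isBigO_sub
  have h1 : (fun x : ℝ => Real.log x * Real.log (1 - x)) =O[nhds 0] fun x => Real.log x * x :=
    (Asymptotics.isBigO_refl _ _).mul hO
  have h2 : Filter.Tendsto (fun x : ℝ => Real.log x * x) (nhds 0) (nhds 0) := by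
    simpa [mul_comm] using Real.continuous_mul_log.tendsto 0
  simpa [ContinuousAt] using h1.trans_tendsto h2

theorem continuousOn_log_mul_log_one_sub :
    ContinuousOn (fun x : ℝ => Real.log x * Real.log (1 - x)) (Set.Icc 0 1) := by
  intro x hx
  apply ContinuousAt.continuousWithinAt
  rcases eq_or_ne x 0 with rfl | h0
  · exact continuousAt_log_mul_log_one_sub_zero
  rcases eq_or_ne x 1 with rfl | h1
  -- The product is symmetric under x ↦ 1 - x, so continuity at 1 follows from that at 0.
  · have h : ContinuousAt (fun x : ℝ => 1 - x) 1 := by fun_prop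
    have := ContinuousAt.comp (f := fun x : ℝ => 1 - x) (x := 1)
      (by simpa using continuousAt_log_mul_log_one_sub_zero) h
    refine this.congr (Filter.Eventually.of_forall fun y => ?_)
    simp [mul_comm]
  · exact (Real.continuousAt_log h0).mul
      (ContinuousAt.log (by fun_prop) (sub_ne_zero.2 h1.symm))

theorem continuousOn_rogersL : ContinuousOn rogersL (Set.Icc 0 1) :=
  continuousOn_realDilog.add (continuousOn_log_mul_log_one_sub.div_const 2)

theorem rogersL_zero : rogersL 0 = 0 := by simp [rogersL, realDilog_zero]

theorem rogersL_one : rogersL 1 = Real.pi ^ 2 / 6 := by simp [rogersL, realDilog_one]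

theorem hasDerivAt_rogersL {x : ℝ} (h0 : 0 < x) (h1 : x < 1) :
    HasDerivAt rogersL ((-Real.log (1 - x) / x - Real.log x / (1 - x)) / 2) x := by
  have h1' : 1 - x ≠ 0 := by linarith
  have hx := h0.ne'
  refine ((hasDerivAt_realDilog h0 h1).add (((Real.hasDerivAt_log hx).mul
    (((hasDerivAt_id x).const_sub 1).log h1')).div_const 2)).congr_deriv ?_
  simp only [id]
  field_simp
  ring

/-! ### Functional equations of the Rogers function. -/

/-- Mean value theorem. Only continuity is asked at 0, where the derivative of `rogersL` has a
logarithmic singularity. -/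
theorem eq_of_hasDerivAt_zero_Ioo {f : ℝ → ℝ} (hc : ContinuousOn f (Set.Ico 0 1))
    (hd : ∀ x ∈ Set.Ioo (0 : ℝ) 1, HasDerivAt f 0 x) {x : ℝ} (h0 : 0 < x) (h1 : x < 1) :
    f x = f 0 := by
  obtain ⟨c, hc1, hc2⟩ := exists_hasDerivAt_eq_slope f (fun _ => 0) h0
    (hc.mono fun y hy => ⟨hy.1, hy.2.trans_lt h1⟩) fun y hy => hd y ⟨hy.1, hy.2.trans h1⟩
  have hx : x - 0 ≠ 0 := by simpa using h0.ne'
  field_simp at hc2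
  linarith

/-- Euler's reflection formula. -/
theorem rogersL_one_sub {x : ℝ} (h0 : 0 < x) (h1 : x < 1) :
    rogersL (1 - x) = Real.pi ^ 2 / 6 - rogersL x := by
  have h := eq_of_hasDerivAt_zero_Ioo (f := fun x => rogersL x + rogersL (1 - x)) ?_ ?_ h0 h1
  · simp only [sub_zero, rogersL_zero, rogersL_one] at h
    linarith
  · refine (continuousOn_rogersL.mono Set.Ico_subset_Icc_self).add
      (continuousOn_rogersL.comp (by fun_prop) fun y hy => ⟨?_, ?_⟩) <;> linarith [hy.1, hy.2]
  · intro y hy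
    have h2 : HasDerivAt (fun x : ℝ => 1 - x) (-1) y := by
      simpa using (hasDerivAt_id y).const_sub 1
    have h3 := (hasDerivAt_rogersL (x := 1 - y) (by linarith [hy.2]) (by linarith [hy.1])).comp y h2
    refine ((hasDerivAt_rogersL hy.1 hy.2).add h3).congr_deriv ?_
    rw [sub_sub_cancel]
    ring

theorem rogersL_half : rogersL (1 / 2) = Real.pi ^ 2 / 12 := by
  have h := rogersL_one_sub (x := 1 / 2) (by norm_num) (by norm_num)
  norm_num at h ⊢
  linarith

/-- With y fixed, the difference of the two sides vanishes at x = 0 and has zero derivative in x. -/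
theorem rogersL_five_term_div {x y : ℝ} (hx0 : 0 < x) (hx1 : x < 1) (hy0 : 0 < y) (hy1 : y < 1) :
    rogersL x + rogersL y = rogersL (x * y) + rogersL (x * (1 - y) / (1 - x * y)) +
      rogersL (y * (1 - x) / (1 - x * y)) := by
  have hw : ∀ z ∈ Set.Ico (0 : ℝ) 1, 0 < 1 - z * y := fun z hz => by nlinarith [hz.1, hz.2]
  have h := eq_of_hasDerivAt_zero_Ioo (f := fun x => rogersL x + rogersL y - rogersL (x * y) -
    rogersL (x * (1 - y) / (1 - x * y)) - rogersL (y * (1 - x) / (1 - x * y))) ?_ ?_ hx0 hx1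
  · simp only [zero_mul, sub_zero, rogersL_zero, mul_one, div_one] at h
    linarith
  · have hc : ContinuousOn (fun z : ℝ => 1 - z * y) (Set.Ico 0 1) := by fun_prop
    refine ((((continuousOn_rogersL.mono Set.Ico_subset_Icc_self).add continuousOn_const).sub
      (continuousOn_rogersL.comp (by fun_prop) ?_)).sub
      (continuousOn_rogersL.comp (ContinuousOn.div (by fun_prop) hc fun z hz => (hw z hz).ne') ?_)).sub
      (continuousOn_rogersL.comp (ContinuousOn.div (by fun_prop) hc fun z hz => (hw z hz).ne') ?_)
    · intro z hz
      exact ⟨mul_nonneg hz.1 hy0.le, by linarith [hw z hz]⟩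
    · intro z hz
      refine ⟨div_nonneg (mul_nonneg hz.1 (by linarith)) (hw z hz).le, ?_⟩
      rw [Pi.div_apply, div_le_one (hw z hz)]
      linarith [hz.2]
    · intro z hz
      refine ⟨div_nonneg (mul_nonneg hy0.le (by linarith [hz.2])) (hw z hz).le, ?_⟩
      beta_reduce
      rw [div_le_one (hw z hz)]
      linarith
  · intro z hz
    have hz0 : 0 < z := hz.1
    have hz1 : 0 < 1 - z := by linarith [hz.2]
    have hy1' : 0 < 1 - y := by linarith
    have hw' : 0 < 1 - z * y := hw z ⟨hz.1.le, hz.2⟩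
    have du : HasDerivAt (fun x : ℝ => x * (1 - y) / (1 - x * y))
        ((1 - y) / (1 - z * y) ^ 2) z := by
      refine (((hasDerivAt_id z).mul_const (1 - y)).div
        (((hasDerivAt_id z).mul_const y).const_sub 1) hw'.ne').congr_deriv ?_
      simp only [id]
      field_simp
      ring
    have dv : HasDerivAt (fun x : ℝ => y * (1 - x) / (1 - x * y))
        (-(y * (1 - y)) / (1 - z * y) ^ 2) z := by
      refine ((((hasDerivAt_id z).const_sub 1).const_mul y).div
        (((hasDerivAt_id z).mul_const y).const_sub 1) hw'.ne').congr_deriv ?_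
      simp only [id]
      field_simp
      ring
    have dxy : HasDerivAt (fun x : ℝ => x * y) y z := by
      simpa using (hasDerivAt_id z).mul_const y
    -- The complements of the two quotients also factor, so every logarithm in the derivative
    -- reduces to those of z, y, 1 - z, 1 - y and 1 - zy, whose coefficients cancel.
    have eu : 1 - z * (1 - y) / (1 - z * y) = (1 - z) / (1 - z * y) := by
      field_simp
      ring
    have ev : 1 - y * (1 - z) / (1 - z * y) = (1 - y) / (1 - z * y) := by
      rw [eq_div_iff hw'.ne', sub_mul, div_mul_cancel₀ _ hw'.ne']
      ring
    have hu1 : z * (1 - y) / (1 - z * y) < 1 := by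
      have : 0 < 1 - z * (1 - y) / (1 - z * y) := eu ▸ by positivity
      linarith
    have hv1 : y * (1 - z) / (1 - z * y) < 1 := by
      have : 0 < 1 - y * (1 - z) / (1 - z * y) := ev ▸ by positivity
      linarith
    have Dxy := (hasDerivAt_rogersL (mul_pos hz0 hy0) (by linarith)).comp z dxy
    have Du := (hasDerivAt_rogersL (by positivity) hu1).comp z du
    have Dv := (hasDerivAt_rogersL (by positivity) hv1).comp z dv
    refine (((((hasDerivAt_rogersL hz0 hz.2).add_const (rogersL y)).sub Dxy).sub Du).sub
      Dv).congr_deriv ?_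
    rw [eu, ev, Real.log_div hz1.ne' hw'.ne', Real.log_div hy1'.ne' hw'.ne',
      Real.log_div (by positivity) hw'.ne', Real.log_div (by positivity) hw'.ne',
      Real.log_mul hz0.ne' hy1'.ne', Real.log_mul hy0.ne' hz1.ne', Real.log_mul hz0.ne' hy0.ne']
    field_simp
    ring

/-- The five-term relation, with the arguments on the right-hand side given implicitly. -/
theorem rogersL_five_term {x y z u v : ℝ} (hx : x ∈ Set.Ioo 0 1) (hy : y ∈ Set.Ioo 0 1)
    (hz : z = x * y) (hu : u * (1 - x * y) = x * (1 - y)) (hv : v * (1 - x * y) = y * (1 - x)) :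
    rogersL x + rogersL y = rogersL z + rogersL u + rogersL v := by
  have hw : 1 - x * y ≠ 0 := by nlinarith [hx.1, hx.2, hy.1, hy.2]
  rw [rogersL_five_term_div hx.1 hx.2 hy.1 hy.2, hz, eq_div_of_mul_eq hw hu, eq_div_of_mul_eq hw hv]

theorem one_sub_mem_Ioo {x : ℝ} (hx : x ∈ Set.Ioo 0 1) : 1 - x ∈ Set.Ioo 0 1 :=
  ⟨sub_pos.2 hx.2, sub_lt_self 1 hx.1⟩

theorem pow_mem_Ioo {x : ℝ} (hx : x ∈ Set.Ioo 0 1) {n : ℕ} (hn : n ≠ 0) : x ^ n ∈ Set.Ioo 0 1 :=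
  ⟨pow_pos hx.1 n, pow_lt_one₀ hx.1.le hx.2 hn⟩

/-- The duplication formula, as the diagonal case of the five-term relation. -/
theorem rogersL_duplication {x z u : ℝ} (hx : x ∈ Set.Ioo 0 1) (hz : z = x * x)
    (hu : u * (1 + x) = x) : 2 * rogersL x = rogersL z + 2 * rogersL u := by
  have h := rogersL_five_term hx hx hz (u := u) (v := u) (by linear_combination (1 - x) * hu)
    (by linear_combination (1 - x) * hu)
  linear_combination h

theorem one_half_mem_Ioo_zero_one : (1 / 2 : ℝ) ∈ Set.Ioo (0 : ℝ) 1 := by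
  constructor <;> norm_num

/-! ### Ladders for the Rogers function. -/

-- An explicit certificate: nineteen instances of the five-term relation (some diagonal) with
-- arguments in ℚ(r), combined so that all auxiliary values cancel.
set_option maxHeartbeats 1000000 in
theorem rogersL_ladder_r {r : ℝ} (hr : r ^ 4 + r ^ 3 - 6 * r ^ 2 + r + 1 = 0)
    (h0 : 548230268 / 10 ^ 9 < r) (h1 : r < 548230269 / 10 ^ 9) :
    3 * rogersL (r ^ 6) + 3 * rogersL (r ^ 4) - 8 * rogersL (r ^ 3) - 33 * rogersL (r ^ 2) + 24 * rogersL r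
      = Real.pi ^ 2 / 6 := by
  have hp : 0 < r := by linarith
  have hl : r < 1 := by linarith
  have l2 : 30055642 / 10 ^ 8 < r ^ 2 :=
    lt_of_lt_of_le (by norm_num) (pow_le_pow_left₀ (by norm_num) h0.le 2)
  have u2 : r ^ 2 < 30055643 / 10 ^ 8 :=
    lt_of_le_of_lt (pow_le_pow_left₀ hp.le h1.le 2) (by norm_num)
  have l3 : 16477413 / 10 ^ 8 < r ^ 3 :=
    lt_of_lt_of_le (by norm_num) (pow_le_pow_left₀ (by norm_num) h0.le 3)
  have u3 : r ^ 3 < 16477414 / 10 ^ 8 :=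
    lt_of_le_of_lt (pow_le_pow_left₀ hp.le h1.le 3) (by norm_num)
  -- The auxiliary arguments, reduced modulo the quartic to cubics in r, so that bounds on r, r² and
  -- r³ place them in (0, 1) by linear arithmetic. The names stay opaque, which makes their
  -- `rogersL` values atoms in the final combination.
  obtain ⟨a₁, ha₁⟩ : ∃ x, x = -1 / 6 + 9 / 4 * r - 1 / 2 * r ^ 2 - 5 / 12 * r ^ 3 := ⟨_, rfl⟩
  obtain ⟨a₂, ha₂⟩ : ∃ x, x = -2 + 6 * r - r ^ 2 - r ^ 3 := ⟨_, rfl⟩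
  obtain ⟨a₃, ha₃⟩ : ∃ x, x = 2 * r - r ^ 2 := ⟨_, rfl⟩
  obtain ⟨a₄, ha₄⟩ : ∃ x, x = 1 / 3 + r ^ 2 + 1 / 3 * r ^ 3 := ⟨_, rfl⟩
  obtain ⟨a₅, ha₅⟩ : ∃ x, x = 1 / 2 + 1 / 2 * r ^ 2 := ⟨_, rfl⟩
  obtain ⟨a₆, ha₆⟩ : ∃ x, x = 1 / 2 + 1 / 2 * r - 1 / 2 * r ^ 2 := ⟨_, rfl⟩
  obtain ⟨a₇, ha₇⟩ : ∃ x, x = -3 / 2 + 4 * r - 1 / 2 * r ^ 3 := ⟨_, rfl⟩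
  obtain ⟨a₈, ha₈⟩ : ∃ x, x = 1 / 3 + 1 / 2 * r - 1 / 6 * r ^ 3 := ⟨_, rfl⟩
  obtain ⟨a₉, ha₉⟩ : ∃ x, x = -r + 3 * r ^ 2 + r ^ 3 := ⟨_, rfl⟩
  obtain ⟨a₁₀, ha₁₀⟩ : ∃ x, x = 1 / 4 + 1 / 4 * r + 1 / 4 * r ^ 2 := ⟨_, rfl⟩
  obtain ⟨a₁₁, ha₁₁⟩ : ∃ x, x = -10 + 43 / 2 * r - 5 / 2 * r ^ 2 - 7 / 2 * r ^ 3 := ⟨_, rfl⟩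
  obtain ⟨a₁₂, ha₁₂⟩ : ∃ x, x = -1 / 2 - 1 / 2 * r + 7 / 2 * r ^ 2 + r ^ 3 := ⟨_, rfl⟩
  obtain ⟨a₁₃, ha₁₃⟩ : ∃ x, x = 1 / 6 + 1 / 3 * r + 1 / 6 * r ^ 2 := ⟨_, rfl⟩
  obtain ⟨a₁₄, ha₁₄⟩ : ∃ x, x = -1 + 2 * r + r ^ 2 := ⟨_, rfl⟩
  obtain ⟨a₁₅, ha₁₅⟩ : ∃ x, x = -1 / 6 + r - 1 / 6 * r ^ 3 := ⟨_, rfl⟩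
  obtain ⟨a₁₆, ha₁₆⟩ : ∃ x, x = 1 / 2 - r + r ^ 2 + 1 / 2 * r ^ 3 := ⟨_, rfl⟩
  obtain ⟨a₁₇, ha₁₇⟩ : ∃ x, x = -9 + 19 * r - 2 * r ^ 2 - 3 * r ^ 3 := ⟨_, rfl⟩
  obtain ⟨a₁₈, ha₁₈⟩ : ∃ x, x = 7 / 48 + 1 / 6 * r + 7 / 48 * r ^ 2 := ⟨_, rfl⟩
  obtain ⟨a₁₉, ha₁₉⟩ : ∃ x, x = -1 / 2 * r + 3 / 2 * r ^ 2 + 1 / 2 * r ^ 3 := ⟨_, rfl⟩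
  obtain ⟨a₂₀, ha₂₀⟩ : ∃ x, x = 1 / 12 + 1 / 2 * r - 1 / 4 * r ^ 2 - 1 / 6 * r ^ 3 := ⟨_, rfl⟩
  obtain ⟨a₂₁, ha₂₁⟩ : ∃ x, x = r - r ^ 2 := ⟨_, rfl⟩
  obtain ⟨a₂₂, ha₂₂⟩ : ∃ x, x = 1 / 8 + 1 / 8 * r + 1 / 8 * r ^ 2 := ⟨_, rfl⟩
  obtain ⟨a₂₃, ha₂₃⟩ : ∃ x, x = 1 / 4 + 3 / 4 * r - 5 / 4 * r ^ 2 - 1 / 2 * r ^ 3 := ⟨_, rfl⟩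
  obtain ⟨a₂₄, ha₂₄⟩ : ∃ x, x = -1 / 2 + r + 1 / 2 * r ^ 2 := ⟨_, rfl⟩
  obtain ⟨a₂₅, ha₂₅⟩ : ∃ x, x = 1 / 6 * r + 1 / 6 * r ^ 2 := ⟨_, rfl⟩
  obtain ⟨a₂₆, ha₂₆⟩ : ∃ x, x = 1 / 48 * r + 1 / 6 * r ^ 2 + 1 / 48 * r ^ 3 := ⟨_, rfl⟩
  obtain ⟨a₂₇, ha₂₇⟩ : ∃ x, x = -1 - r + 7 * r ^ 2 - 3 * r ^ 3 := ⟨_, rfl⟩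
  have mr : r ∈ Set.Ioo 0 1 := ⟨hp, hl⟩
  have mr2 : r ^ 2 ∈ Set.Ioo 0 1 := pow_mem_Ioo mr (by norm_num)
  have mr3 : r ^ 3 ∈ Set.Ioo 0 1 := pow_mem_Ioo mr (by norm_num)
  have mr4 : r ^ 4 ∈ Set.Ioo 0 1 := pow_mem_Ioo mr (by norm_num)
  have ma₁ : a₁ ∈ Set.Ioo 0 1 := by constructor <;> linarith only [h0, h1, l2, u2, l3, u3, ha₁]
  have ma₂ : a₂ ∈ Set.Ioo 0 1 := by constructor <;> linarith only [h0, h1, l2, u2, l3, u3, ha₂]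
  have ma₃ : a₃ ∈ Set.Ioo 0 1 := by constructor <;> linarith only [h0, h1, l2, u2, l3, u3, ha₃]
  have ma₄ : a₄ ∈ Set.Ioo 0 1 := by constructor <;> linarith only [h0, h1, l2, u2, l3, u3, ha₄]
  have ma₅ : a₅ ∈ Set.Ioo 0 1 := by constructor <;> linarith only [h0, h1, l2, u2, l3, u3, ha₅]
  have ma₆ : a₆ ∈ Set.Ioo 0 1 := by constructor <;> linarith only [h0, h1, l2, u2, l3, u3, ha₆]
  have ma₇ : a₇ ∈ Set.Ioo 0 1 := by constructor <;> linarith only [h0, h1, l2, u2, l3, u3, ha₇]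
  have ma₈ : a₈ ∈ Set.Ioo 0 1 := by constructor <;> linarith only [h0, h1, l2, u2, l3, u3, ha₈]
  have ma₉ : a₉ ∈ Set.Ioo 0 1 := by constructor <;> linarith only [h0, h1, l2, u2, l3, u3, ha₉]
  have ma₁₀ : a₁₀ ∈ Set.Ioo 0 1 := by constructor <;> linarith only [h0, h1, l2, u2, l3, u3, ha₁₀]
  have ma₁₁ : a₁₁ ∈ Set.Ioo 0 1 := by constructor <;> linarith only [h0, h1, l2, u2, l3, u3, ha₁₁]
  have ma₁₂ : a₁₂ ∈ Set.Ioo 0 1 := by constructor <;> linarith only [h0, h1, l2, u2, l3, u3, ha₁₂]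
  have ma₁₃ : a₁₃ ∈ Set.Ioo 0 1 := by constructor <;> linarith only [h0, h1, l2, u2, l3, u3, ha₁₃]
  have ma₁₄ : a₁₄ ∈ Set.Ioo 0 1 := by constructor <;> linarith only [h0, h1, l2, u2, l3, u3, ha₁₄]
  have ma₁₅ : a₁₅ ∈ Set.Ioo 0 1 := by constructor <;> linarith only [h0, h1, l2, u2, l3, u3, ha₁₅]
  have ma₁₇ : a₁₇ ∈ Set.Ioo 0 1 := by constructor <;> linarith only [h0, h1, l2, u2, l3, u3, ha₁₇]
  have ma₁₈ : a₁₈ ∈ Set.Ioo 0 1 := by constructor <;> linarith only [h0, h1, l2, u2, l3, u3, ha₁₈]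
  have ma₂₀ : a₂₀ ∈ Set.Ioo 0 1 := by constructor <;> linarith only [h0, h1, l2, u2, l3, u3, ha₂₀]
  have ma₂₁ : a₂₁ ∈ Set.Ioo 0 1 := by constructor <;> linarith only [h0, h1, l2, u2, l3, u3, ha₂₁]
  -- In each side condition, the multiplier of `hr` is the quotient of the difference of the two
  -- sides by the quartic.
  have h₁ := rogersL_duplication (z := r ^ 6) (u := a₂₅) mr3
    (by ring)
    (by rw [ha₂₅]; linear_combination (1 / 6 * r) * hr)
  have h₂ := rogersL_duplication (z := a₂₇) (u := a₂₄) ma₂₁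
    (by rw [ha₂₁, ha₂₇]; linear_combination (-1) * hr)
    (by rw [ha₂₁, ha₂₄]; linear_combination (-1 / 2) * hr)
  have h₃ := rogersL_duplication (z := a₂₆) (u := a₂₃) ma₂₀
    (by rw [ha₂₀, ha₂₆]; linear_combination (-1 / 144 - 1 / 18 * r - 1 / 36 * r ^ 2) * hr)
    (by rw [ha₂₀, ha₂₃]; linear_combination (3 / 16 + 1 / 4 * r + 1 / 12 * r ^ 2) * hr)
  have h₄ := rogersL_five_term (z := r ^ 6) (u := a₁₈) (v := a₂₆)
    mr2 mr4
    (by ring)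
    (by rw [ha₁₈]; linear_combination (7 / 48 + 1 / 48 * r - 1 / 48 * r ^ 3 - 7 / 48 * r ^ 4) *
      hr)
    (by rw [ha₂₆]; linear_combination (1 / 48 * r + 7 / 48 * r ^ 2 - 7 / 48 * r ^ 4 - 1 / 48 * r ^
      5) * hr)
  have h₅ := rogersL_five_term (z := a₂₇) (u := a₂₀) (v := 1 - a₁)
    mr2 (one_sub_mem_Ioo ma₃)
    (by rw [ha₃, ha₂₇]; linear_combination (-1) * hr)
    (by rw [ha₃, ha₂₀]; linear_combination (1 / 12 + 5 / 12 * r - 1 / 4 * r ^ 2 + 1 / 6 * r ^ 3) *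
      hr)
    (by rw [ha₃, ha₁]; linear_combination (1 / 6 - 5 / 12 * r + 3 / 4 * r ^ 2 - 5 / 12 * r ^ 3) *
      hr)
  have h₆ := rogersL_duplication (z := r ^ 4) (u := a₂₂) mr2
    (by ring)
    (by rw [ha₂₂]; linear_combination (1 / 8) * hr)
  have h₇ := rogersL_five_term (z := a₂₅) (u := r ^ 2) (v := a₂₁)
    ma₁₃ ma₁₅
    (by rw [ha₁₃, ha₁₅, ha₂₅]; linear_combination (1 / 36 + 1 / 36 * r) * hr)
    (by rw [ha₁₃, ha₁₅]; linear_combination (-7 / 36 - 1 / 36 * r + 1 / 36 * r ^ 2 + 1 / 36 * r ^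
      3) * hr)
    (by rw [ha₁₃, ha₁₅, ha₂₁]; linear_combination (5 / 36 - 1 / 36 * r ^ 3) * hr)
  have h₈ := rogersL_five_term (z := 1 - a₂) (u := a₁₆) (v := a₁₉)
    (one_sub_mem_Ioo mr) (one_sub_mem_Ioo ma₇)
    (by rw [ha₇, ha₂]; linear_combination (1 / 2) * hr)
    (by rw [ha₇, ha₁₆]; linear_combination (3 / 4 - 3 / 2 * r + 1 / 4 * r ^ 3) * hr)
    (by rw [ha₇, ha₁₉]; linear_combination (-7 / 4 * r + 1 / 4 * r ^ 2 + 1 / 4 * r ^ 3) * hr)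
  have h₉ := rogersL_duplication (z := 1 - a₃) (u := 1 - a₄) (one_sub_mem_Ioo mr)
    (by rw [ha₃]; ring)
    (by rw [ha₄]; linear_combination (1 / 3) * hr)
  have h₁₀ := rogersL_five_term (z := a₂₃) (u := a₁₇) (v := r ^ 2)
    ma₁₁ ma₁₂
    (by rw [ha₁₁, ha₁₂, ha₂₃]; linear_combination (-19 / 4 + 45 / 4 * r + 7 / 2 * r ^ 2) * hr)
    (by rw [ha₁₁, ha₁₂, ha₁₇]; linear_combination (51 - 206 * r + 747 / 4 * r ^ 2 + 233 / 4 * r ^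
      3 - 163 / 4 * r ^ 4 - 21 / 2 * r ^ 5) * hr)
    (by rw [ha₁₁, ha₁₂]; linear_combination (11 / 2 - 43 / 4 * r - 33 / 4 * r ^ 2 + 45 / 4 * r ^ 3
      + 7 / 2 * r ^ 4) * hr)
  have h₁₁ := rogersL_five_term (z := a₂₄) (u := 1 - a₆) (v := a₂₁)
    one_half_mem_Ioo_zero_one ma₁₄
    (by rw [ha₁₄, ha₂₄]; ring)
    (by rw [ha₁₄, ha₆]; linear_combination (-1 / 4) * hr)
    (by rw [ha₁₄, ha₂₁]; linear_combination (1 / 2) * hr)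
  have h₁₂ := rogersL_five_term (z := a₂₂) (u := 1 - a₅) (v := r ^ 2)
    one_half_mem_Ioo_zero_one ma₁₀
    (by rw [ha₁₀, ha₂₂]; ring)
    (by rw [ha₁₀, ha₅]; linear_combination (1 / 16) * hr)
    (by rw [ha₁₀]; linear_combination (-1 / 8) * hr)
  have h₁₃ := rogersL_five_term (z := a₁₉) (u := 1 - a₆) (v := r ^ 2)
    (one_sub_mem_Ioo ma₁₀) (one_sub_mem_Ioo ma₉)
    (by rw [ha₁₀, ha₉, ha₁₉]; linear_combination (-3 / 4 - 1 / 4 * r) * hr)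
    (by rw [ha₁₀, ha₉, ha₆]; linear_combination (1 / 8 + 1 / 4 * r - 1 / 4 * r ^ 2 - 1 / 8 * r ^
      3) * hr)
    (by rw [ha₁₀, ha₉]; linear_combination (-1 / 4 - 1 / 4 * r - 3 / 4 * r ^ 2 - 1 / 4 * r ^ 3) *
      hr)
  have h₁₄ := rogersL_five_term (z := 1 - a₁) (u := a₁₁) (v := 1 - a₁)
    (one_sub_mem_Ioo ma₁₁) ma₁₈
    (by rw [ha₁₁, ha₁₈, ha₁]; linear_combination (-7 / 16 - 49 / 96 * r) * hr)
    (by rw [ha₁₁, ha₁₈]; linear_combination (-161 / 48 - 59 / 24 * r - 539 / 64 * r ^ 2 + 539 /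
      192 * r ^ 3 + 343 / 192 * r ^ 4) * hr)
    (by rw [ha₁₁, ha₁₈, ha₁]; linear_combination (217 / 288 + 21 / 32 * r + 871 / 1152 * r ^ 2 - 7
      / 16 * r ^ 3 - 245 / 1152 * r ^ 4) * hr)
  have h₁₅ := rogersL_five_term (z := 1 - a₂) (u := 1 - r) (v := 1 - a₂)
    mr ma₁₇
    (by rw [ha₁₇, ha₂]; linear_combination (3) * hr)
    (by rw [ha₁₇]; linear_combination (1 - 3 * r) * hr)
    (by rw [ha₁₇, ha₂]; linear_combination (12 - 19 * r + 2 * r ^ 2 + 3 * r ^ 3) * hr)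
  have h₁₆ := rogersL_duplication (z := r ^ 2) (u := a₁₅) mr
    (by ring)
    (by rw [ha₁₅]; linear_combination (-1 / 6) * hr)
  have h₁₇ := rogersL_five_term (z := r ^ 2) (u := a₁₃) (v := 1 - a₄)
    ma₈ ma₉
    (by rw [ha₈, ha₉]; linear_combination (1 / 3 * r + 1 / 6 * r ^ 2) * hr)
    (by rw [ha₈, ha₉, ha₁₃]; linear_combination (-1 / 6 - 5 / 18 * r - 1 / 36 * r ^ 2 + 1 / 9 * r
      ^ 3 + 1 / 36 * r ^ 4) * hr)
    (by rw [ha₈, ha₉, ha₄]; linear_combination (2 / 3 + 2 / 9 * r - 1 / 18 * r ^ 2 - 1 / 3 * r ^ 3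
      - 5 / 18 * r ^ 4 - 1 / 18 * r ^ 5) * hr)
  have h₁₈ := rogersL_five_term (z := a₁₆) (u := a₁₃) (v := a₁₆)
    (one_sub_mem_Ioo ma₁₃) (one_sub_mem_Ioo ma₁₂)
    (by rw [ha₁₃, ha₁₂, ha₁₆]; linear_combination (-3 / 4 - 1 / 6 * r) * hr)
    (by rw [ha₁₃, ha₁₂]; linear_combination (3 / 8 - 7 / 36 * r - 13 / 72 * r ^ 2 - 1 / 36 * r ^
      3) * hr)
    (by rw [ha₁₃, ha₁₂, ha₁₆]; linear_combination (-3 / 8 + 1 / 12 * r - 5 / 6 * r ^ 2 - 13 / 24 *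
      r ^ 3 - 1 / 12 * r ^ 4) * hr)
  have h₁₉ := rogersL_five_term (z := 1 - a₅) (u := 1 - a₇) (v := a₁₅)
    (one_sub_mem_Ioo ma₁₄) ma₈
    (by rw [ha₁₄, ha₈, ha₅]; linear_combination (-1 / 6 - 1 / 6 * r) * hr)
    (by rw [ha₁₄, ha₈, ha₇]; linear_combination (-1 / 2 + 2 / 3 * r + 2 / 3 * r ^ 2 - 1 / 12 * r ^
      3 - 1 / 12 * r ^ 4) * hr)
    (by rw [ha₁₄, ha₈, ha₁₅]; linear_combination (5 / 18 - 1 / 18 * r - 1 / 6 * r ^ 2 + 1 / 36 * r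
      ^ 3 + 1 / 36 * r ^ 4) * hr)
  -- The values at 1/2 cancel between `h₁₁` and `h₁₂`; the reflection coefficients add up to 1,
  -- leaving π²/6.
  linear_combination -4 * h₁ + 2 * h₂ - h₃ + h₄ - 2 * h₅ - 2 * h₆ + 8 * h₇ - 4 * h₈ - 2 * h₉ + 2 *
    h₁₀ - 4 * h₁₁ + 4 * h₁₂ + 4 * h₁₃ + h₁₄ + 2 * h₁₅ + 6 * h₁₆ + 4 * h₁₇ + 2 * h₁₈ - 4 * h₁₉ + 10
    * rogersL_one_sub mr.1 mr.2 - 4 * rogersL_one_sub ma₁₀.1 ma₁₀.2 - 4 * rogersL_one_sub ma₉.1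
    ma₉.2 - rogersL_one_sub ma₁₁.1 ma₁₁.2 - 2 * rogersL_one_sub ma₁₃.1 ma₁₃.2 - 2 *
    rogersL_one_sub ma₁₂.1 ma₁₂.2 + 4 * rogersL_one_sub ma₁₄.1 ma₁₄.2

-- The same kind of certificate, with eighteen relations and the quartic with x replaced by -x.
set_option maxHeartbeats 1000000 in
theorem rogersL_ladder_r₂ {r : ℝ} (hr : r ^ 4 - r ^ 3 - 6 * r ^ 2 - r + 1 = 0)
    (h0 : 328543397 / 10 ^ 9 < r) (h1 : r < 328543398 / 10 ^ 9) :
    rogersL (r ^ 6) - 3 * rogersL (r ^ 4) - 8 * rogersL (r ^ 3) + 21 * rogersL (r ^ 2) + 24 * rogersL r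
      = 11 * Real.pi ^ 2 / 6 := by
  have hp : 0 < r := by linarith
  have hl : r < 1 := by linarith
  have l2 : 10794076 / 10 ^ 8 < r ^ 2 :=
    lt_of_lt_of_le (by norm_num) (pow_le_pow_left₀ (by norm_num) h0.le 2)
  have u2 : r ^ 2 < 10794077 / 10 ^ 8 :=
    lt_of_le_of_lt (pow_le_pow_left₀ hp.le h1.le 2) (by norm_num)
  have l3 : 3546322 / 10 ^ 8 < r ^ 3 :=
    lt_of_lt_of_le (by norm_num) (pow_le_pow_left₀ (by norm_num) h0.le 3)
  have u3 : r ^ 3 < 3546323 / 10 ^ 8 :=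
    lt_of_le_of_lt (pow_le_pow_left₀ hp.le h1.le 3) (by norm_num)
  obtain ⟨a₁, ha₁⟩ : ∃ x, x = 1 / 6 + 9 / 4 * r + 1 / 2 * r ^ 2 - 5 / 12 * r ^ 3 := ⟨_, rfl⟩
  obtain ⟨a₂, ha₂⟩ : ∃ x, x = 1 / 2 + 3 / 2 * r - 1 / 2 * r ^ 2 := ⟨_, rfl⟩
  obtain ⟨a₃, ha₃⟩ : ∃ x, x = 1 / 2 + r + r ^ 2 - 1 / 2 * r ^ 3 := ⟨_, rfl⟩
  obtain ⟨a₄, ha₄⟩ : ∃ x, x = -5 / 3 + 7 * r + 2 * r ^ 2 - 4 / 3 * r ^ 3 := ⟨_, rfl⟩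
  obtain ⟨a₅, ha₅⟩ : ∃ x, x = -1 / 3 + 3 * r + r ^ 2 - 2 / 3 * r ^ 3 := ⟨_, rfl⟩
  obtain ⟨a₆, ha₆⟩ : ∃ x, x = r + 3 * r ^ 2 - r ^ 3 := ⟨_, rfl⟩
  obtain ⟨a₇, ha₇⟩ : ∃ x, x = 5 / 3 * r + 2 / 3 * r ^ 2 - 1 / 3 * r ^ 3 := ⟨_, rfl⟩
  obtain ⟨a₈, ha₈⟩ : ∃ x, x = 1 / 2 + 1 / 2 * r ^ 2 := ⟨_, rfl⟩
  obtain ⟨a₉, ha₉⟩ : ∃ x, x = -9 / 4 + 31 / 4 * r + 9 / 4 * r ^ 2 - 3 / 2 * r ^ 3 := ⟨_, rfl⟩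
  obtain ⟨a₁₀, ha₁₀⟩ : ∃ x, x = r + r ^ 2 := ⟨_, rfl⟩
  obtain ⟨a₁₁, ha₁₁⟩ : ∃ x, x = -3 / 2 + 11 / 2 * r + 3 / 2 * r ^ 2 - r ^ 3 := ⟨_, rfl⟩
  obtain ⟨a₁₂, ha₁₂⟩ : ∃ x, x = 1 / 3 + r ^ 2 - 1 / 3 * r ^ 3 := ⟨_, rfl⟩
  obtain ⟨a₁₃, ha₁₃⟩ : ∃ x, x = 1 / 2 * r + 3 / 2 * r ^ 2 - 1 / 2 * r ^ 3 := ⟨_, rfl⟩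
  obtain ⟨a₁₄, ha₁₄⟩ : ∃ x, x = 5 / 6 * r + 1 / 3 * r ^ 2 - 1 / 6 * r ^ 3 := ⟨_, rfl⟩
  obtain ⟨a₁₅, ha₁₅⟩ : ∃ x, x = 1 / 2 - 1 / 2 * r - 1 / 2 * r ^ 2 := ⟨_, rfl⟩
  obtain ⟨a₁₆, ha₁₆⟩ : ∃ x, x = -1 / 2 + 2 * r + r ^ 2 - 1 / 2 * r ^ 3 := ⟨_, rfl⟩
  obtain ⟨a₁₇, ha₁₇⟩ : ∃ x, x = 1 / 4 - 1 / 4 * r + 1 / 4 * r ^ 2 := ⟨_, rfl⟩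
  obtain ⟨a₁₈, ha₁₈⟩ : ∃ x, x = -1 + r + 7 * r ^ 2 + 3 * r ^ 3 := ⟨_, rfl⟩
  obtain ⟨a₁₉, ha₁₉⟩ : ∃ x, x = 1 / 3 - 1 / 2 * r + 1 / 6 * r ^ 3 := ⟨_, rfl⟩
  obtain ⟨a₂₀, ha₂₀⟩ : ∃ x, x = 7 / 48 - 1 / 6 * r + 7 / 48 * r ^ 2 := ⟨_, rfl⟩
  obtain ⟨a₂₁, ha₂₁⟩ : ∃ x, x = -1 / 12 + 1 / 2 * r + 1 / 4 * r ^ 2 - 1 / 6 * r ^ 3 := ⟨_, rfl⟩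
  obtain ⟨a₂₂, ha₂₂⟩ : ∃ x, x = 1 / 8 - 1 / 8 * r + 1 / 8 * r ^ 2 := ⟨_, rfl⟩
  obtain ⟨a₂₃, ha₂₃⟩ : ∃ x, x = 1 / 2 * r - 1 / 2 * r ^ 2 - 1 / 2 * r ^ 3 := ⟨_, rfl⟩
  obtain ⟨a₂₄, ha₂₄⟩ : ∃ x, x = 1 / 6 - 1 / 3 * r + 1 / 6 * r ^ 2 := ⟨_, rfl⟩
  obtain ⟨a₂₅, ha₂₅⟩ : ∃ x, x = -1 / 48 * r + 1 / 6 * r ^ 2 - 1 / 48 * r ^ 3 := ⟨_, rfl⟩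
  obtain ⟨a₂₆, ha₂₆⟩ : ∃ x, x = -1 / 2 + 1 / 2 * r + 7 / 2 * r ^ 2 - r ^ 3 := ⟨_, rfl⟩
  have mr : r ∈ Set.Ioo 0 1 := ⟨hp, hl⟩
  have mr2 : r ^ 2 ∈ Set.Ioo 0 1 := pow_mem_Ioo mr (by norm_num)
  have mr4 : r ^ 4 ∈ Set.Ioo 0 1 := pow_mem_Ioo mr (by norm_num)
  have ma₁ : a₁ ∈ Set.Ioo 0 1 := by constructor <;> linarith only [h0, h1, l2, u2, l3, u3, ha₁]
  have ma₂ : a₂ ∈ Set.Ioo 0 1 := by constructor <;> linarith only [h0, h1, l2, u2, l3, u3, ha₂]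
  have ma₃ : a₃ ∈ Set.Ioo 0 1 := by constructor <;> linarith only [h0, h1, l2, u2, l3, u3, ha₃]
  have ma₄ : a₄ ∈ Set.Ioo 0 1 := by constructor <;> linarith only [h0, h1, l2, u2, l3, u3, ha₄]
  have ma₅ : a₅ ∈ Set.Ioo 0 1 := by constructor <;> linarith only [h0, h1, l2, u2, l3, u3, ha₅]
  have ma₆ : a₆ ∈ Set.Ioo 0 1 := by constructor <;> linarith only [h0, h1, l2, u2, l3, u3, ha₆]
  have ma₇ : a₇ ∈ Set.Ioo 0 1 := by constructor <;> linarith only [h0, h1, l2, u2, l3, u3, ha₇]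
  have ma₈ : a₈ ∈ Set.Ioo 0 1 := by constructor <;> linarith only [h0, h1, l2, u2, l3, u3, ha₈]
  have ma₉ : a₉ ∈ Set.Ioo 0 1 := by constructor <;> linarith only [h0, h1, l2, u2, l3, u3, ha₉]
  have ma₁₀ : a₁₀ ∈ Set.Ioo 0 1 := by constructor <;> linarith only [h0, h1, l2, u2, l3, u3, ha₁₀]
  have ma₁₁ : a₁₁ ∈ Set.Ioo 0 1 := by constructor <;> linarith only [h0, h1, l2, u2, l3, u3, ha₁₁]
  have ma₁₂ : a₁₂ ∈ Set.Ioo 0 1 := by constructor <;> linarith only [h0, h1, l2, u2, l3, u3, ha₁₂]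
  have ma₁₃ : a₁₃ ∈ Set.Ioo 0 1 := by constructor <;> linarith only [h0, h1, l2, u2, l3, u3, ha₁₃]
  have ma₁₅ : a₁₅ ∈ Set.Ioo 0 1 := by constructor <;> linarith only [h0, h1, l2, u2, l3, u3, ha₁₅]
  have ma₁₆ : a₁₆ ∈ Set.Ioo 0 1 := by constructor <;> linarith only [h0, h1, l2, u2, l3, u3, ha₁₆]
  have ma₁₇ : a₁₇ ∈ Set.Ioo 0 1 := by constructor <;> linarith only [h0, h1, l2, u2, l3, u3, ha₁₇]
  have ma₁₈ : a₁₈ ∈ Set.Ioo 0 1 := by constructor <;> linarith only [h0, h1, l2, u2, l3, u3, ha₁₈]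
  have ma₁₉ : a₁₉ ∈ Set.Ioo 0 1 := by constructor <;> linarith only [h0, h1, l2, u2, l3, u3, ha₁₉]
  have ma₂₀ : a₂₀ ∈ Set.Ioo 0 1 := by constructor <;> linarith only [h0, h1, l2, u2, l3, u3, ha₂₀]
  have ma₂₁ : a₂₁ ∈ Set.Ioo 0 1 := by constructor <;> linarith only [h0, h1, l2, u2, l3, u3, ha₂₁]
  have h₁ := rogersL_duplication (z := a₂₆) (u := a₂₄) (one_sub_mem_Ioo ma₃)
    (by rw [ha₃, ha₂₆]; linear_combination (-3 / 4 + 3 / 4 * r - 1 / 4 * r ^ 2) * hr)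
    (by rw [ha₃, ha₂₄]; linear_combination (-1 / 4 + 1 / 12 * r) * hr)
  have h₂ := rogersL_duplication (z := a₂₅) (u := a₂₃) ma₂₁
    (by rw [ha₂₁, ha₂₅]; linear_combination (-1 / 144 + 1 / 18 * r - 1 / 36 * r ^ 2) * hr)
    (by rw [ha₂₁, ha₂₃]; linear_combination (1 / 12 + 1 / 24 * r + 1 / 12 * r ^ 2) * hr)
  have h₃ := rogersL_five_term (z := r ^ 6) (u := a₂₀) (v := a₂₅)
    mr2 mr4
    (by ring)
    (by rw [ha₂₀]; linear_combination (7 / 48 - 1 / 48 * r + 1 / 48 * r ^ 3 - 7 / 48 * r ^ 4) *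
      hr)
    (by rw [ha₂₅]; linear_combination (-1 / 48 * r + 7 / 48 * r ^ 2 - 7 / 48 * r ^ 4 + 1 / 48 * r
      ^ 5) * hr)
  have h₄ := rogersL_five_term (z := a₂₆) (u := a₂₁) (v := 1 - a₁)
    mr2 (one_sub_mem_Ioo ma₂)
    (by rw [ha₂, ha₂₆]; linear_combination (-1 / 2) * hr)
    (by rw [ha₂, ha₂₁]; linear_combination (-1 / 12 + 5 / 12 * r - 7 / 24 * r ^ 2 + 1 / 12 * r ^
      3) * hr)
    (by rw [ha₂, ha₁]; linear_combination (1 / 3 - 5 / 12 * r + 2 / 3 * r ^ 2 - 5 / 24 * r ^ 3) *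
      hr)
  have h₅ := rogersL_duplication (z := r ^ 4) (u := a₂₂) mr2
    (by ring)
    (by rw [ha₂₂]; linear_combination (1 / 8) * hr)
  have h₆ := rogersL_duplication (z := 1 - a₂) (u := 1 - a₄) ma₁₆
    (by rw [ha₁₆, ha₂]; linear_combination (1 / 4 + 3 / 4 * r - 1 / 4 * r ^ 2) * hr)
    (by rw [ha₁₆, ha₄]; linear_combination (11 / 6 + 5 / 3 * r - 2 / 3 * r ^ 2) * hr)
  have h₇ := rogersL_five_term (z := 1 - a₃) (u := a₁₆) (v := 1 - a₄)
    ma₁₃ (one_sub_mem_Ioo ma₅)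
    (by rw [ha₁₃, ha₅, ha₃]; linear_combination (1 / 2 - 7 / 6 * r + 1 / 3 * r ^ 2) * hr)
    (by rw [ha₁₃, ha₅, ha₁₆]; linear_combination (-1 / 2 + 2 * r - 25 / 12 * r ^ 2 - 3 / 4 * r ^ 3
      + 11 / 12 * r ^ 4 - 1 / 6 * r ^ 5) * hr)
    (by rw [ha₁₃, ha₅, ha₄]; linear_combination (4 / 3 - 34 / 9 * r + 127 / 18 * r ^ 2 + 2 / 3 * r
      ^ 3 - 20 / 9 * r ^ 4 + 4 / 9 * r ^ 5) * hr)
  have h₈ := rogersL_five_term (z := r ^ 3) (u := a₁₄) (v := a₂₄)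
    mr mr2
    (by ring)
    (by rw [ha₁₄]; linear_combination (-1 / 6 * r + 1 / 6 * r ^ 2) * hr)
    (by rw [ha₂₄]; linear_combination (1 / 6 - 1 / 6 * r) * hr)
  have h₉ := rogersL_duplication (z := r ^ 2) (u := a₁₆) mr
    (by ring)
    (by rw [ha₁₆]; linear_combination (-1 / 2) * hr)
  have h₁₀ := rogersL_five_term (z := r ^ 2) (u := a₁₃) (v := a₁₇)
    (one_sub_mem_Ioo ma₆) ma₁₅
    (by rw [ha₆, ha₁₅]; linear_combination (-1 / 2 + 1 / 2 * r) * hr)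
    (by rw [ha₆, ha₁₅, ha₁₃]; linear_combination (-1 / 2 - 1 / 4 * r - 1 / 2 * r ^ 2 + r ^ 3 - 1 /
      4 * r ^ 4) * hr)
    (by rw [ha₆, ha₁₅, ha₁₇]; linear_combination (1 / 8 - 1 / 4 * r - 1 / 4 * r ^ 2 + 1 / 8 * r ^
      3) * hr)
  have h₁₁ := rogersL_five_term (z := a₂₄) (u := 1 - a₆) (v := r ^ 2)
    ma₁₂ ma₁₉
    (by rw [ha₁₂, ha₁₉, ha₂₄]; linear_combination (1 / 18 - 1 / 9 * r + 1 / 18 * r ^ 2) * hr)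
    (by rw [ha₁₂, ha₁₉, ha₆]; linear_combination (2 / 3 - 2 / 9 * r - 1 / 18 * r ^ 2 + 1 / 3 * r ^
      3 - 5 / 18 * r ^ 4 + 1 / 18 * r ^ 5) * hr)
    (by rw [ha₁₂, ha₁₉]; linear_combination (-2 / 9 + 1 / 9 * r - 1 / 9 * r ^ 3 + 1 / 18 * r ^ 4)
      * hr)
  have h₁₂ := rogersL_duplication (z := a₁₈) (u := a₁₄) ma₁₀
    (by rw [ha₁₀, ha₁₈]; linear_combination (-1) * hr)
    (by rw [ha₁₀, ha₁₄]; linear_combination (-1 / 6 * r) * hr)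
  have h₁₃ := rogersL_five_term (z := a₁₉) (u := r) (v := 1 - a₅)
    (one_sub_mem_Ioo ma₈) (one_sub_mem_Ioo ma₇)
    (by rw [ha₈, ha₇, ha₁₉]; linear_combination (-1 / 6 + 1 / 6 * r) * hr)
    (by rw [ha₈, ha₇]; linear_combination (-1 / 3 * r + 1 / 6 * r ^ 2) * hr)
    (by rw [ha₈, ha₇, ha₅]; linear_combination (1 / 6 + 11 / 18 * r - 4 / 9 * r ^ 2 - 5 / 18 * r ^
      3 + 1 / 9 * r ^ 4) * hr)
  have h₁₄ := rogersL_five_term (z := a₂₃) (u := a₁₁) (v := r ^ 2)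
    ma₉ ma₁₈
    (by rw [ha₉, ha₁₈, ha₂₃]; linear_combination (-9 / 4 + 33 / 4 * r + 9 / 2 * r ^ 2) * hr)
    (by rw [ha₉, ha₁₈, ha₁₁]; linear_combination (51 / 8 - 133 / 4 * r + 121 / 4 * r ^ 2 + 315 / 8
      * r ^ 3 - 3 / 2 * r ^ 4 - 9 / 2 * r ^ 5) * hr)
    (by rw [ha₉, ha₁₈]; linear_combination (13 / 4 - 31 / 4 * r - 27 / 4 * r ^ 2 + 33 / 4 * r ^ 3
      + 9 / 2 * r ^ 4) * hr)
  have h₁₅ := rogersL_five_term (z := a₂₂) (u := 1 - a₈) (v := r ^ 2)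
    one_half_mem_Ioo_zero_one ma₁₇
    (by rw [ha₁₇, ha₂₂]; ring)
    (by rw [ha₁₇, ha₈]; linear_combination (1 / 16) * hr)
    (by rw [ha₁₇]; linear_combination (-1 / 8) * hr)
  have h₁₆ := rogersL_five_term (z := 1 - a₁) (u := a₉) (v := 1 - a₁)
    (one_sub_mem_Ioo ma₉) ma₂₀
    (by rw [ha₉, ha₂₀, ha₁]; linear_combination (23 / 64 - 7 / 32 * r) * hr)
    (by rw [ha₉, ha₂₀]; linear_combination (-3041 / 768 + 623 / 256 * r - 67 / 256 * r ^ 2 - 33 /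
      32 * r ^ 3 + 21 / 64 * r ^ 4) * hr)
    (by rw [ha₉, ha₂₀, ha₁]; linear_combination (883 / 1152 - 1219 / 2304 * r + 5 / 36 * r ^ 2 +
      199 / 768 * r ^ 3 - 35 / 384 * r ^ 4) * hr)
  have h₁₇ := rogersL_five_term (z := a₁₅) (u := 1 - a₇) (v := a₁₄)
    (one_sub_mem_Ioo ma₁₀) one_half_mem_Ioo_zero_one
    (by rw [ha₁₀, ha₁₅]; ring)
    (by rw [ha₁₀, ha₇]; linear_combination (1 / 6 * r) * hr)
    (by rw [ha₁₀, ha₁₄]; linear_combination (-1 / 12 * r) * hr)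
  have h₁₈ := rogersL_five_term (z := a₁₆) (u := a₁₂) (v := a₁₆)
    (one_sub_mem_Ioo ma₁₂) ma₁₁
    (by rw [ha₁₂, ha₁₁, ha₁₆]; linear_combination (1 / 2 - 7 / 6 * r + 1 / 3 * r ^ 2) * hr)
    (by rw [ha₁₂, ha₁₁]; linear_combination (-1 + 13 / 9 * r + 1 / 9 * r ^ 2 - 4 / 3 * r ^ 3 + 13
      / 18 * r ^ 4 - 1 / 9 * r ^ 5) * hr)
    (by rw [ha₁₂, ha₁₁, ha₁₆]; linear_combination (-1 / 2 + 7 / 2 * r - 31 / 12 * r ^ 2 - 3 / 4 *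
      r ^ 3 + 11 / 12 * r ^ 4 - 1 / 6 * r ^ 5) * hr)
  -- Reflections contribute 7π²/6, and the value at 1/2, left over from `h₁₅` and `h₁₇`, contributes
  -- 8π²/12.
  linear_combination -2 * h₁ + h₂ - h₃ + 2 * h₄ + 2 * h₅ + 2 * h₆ - 4 * h₇ + 8 * h₈ + 6 * h₉ - 4 *
    h₁₀ - 4 * h₁₁ - 2 * h₁₂ - 4 * h₁₃ - 2 * h₁₄ - 4 * h₁₅ - h₁₆ - 4 * h₁₇ - 2 * h₁₈ +
    rogersL_one_sub ma₉.1 ma₉.2 + 4 * rogersL_one_sub ma₁₀.1 ma₁₀.2 + 2 * rogersL_one_sub ma₁₂.1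
    ma₁₂.2 + 8 * rogersL_half

/-! ### From the Rogers function back to the dilogarithm. -/

theorem rogersL_pow {r : ℝ} (n : ℕ) :
    rogersL (r ^ n) = realDilog (r ^ n) + n * Real.log r * Real.log (1 - r ^ n) / 2 := by
  rw [rogersL, Real.log_pow]

theorem realDilog_ladder_r {r : ℝ} (hr : r ^ 4 + r ^ 3 - 6 * r ^ 2 + r + 1 = 0)
    (h0 : 548230268 / 10 ^ 9 < r) (h1 : r < 548230269 / 10 ^ 9) :
    3 * realDilog (r ^ 6) + 3 * realDilog (r ^ 4) - 8 * realDilog (r ^ 3)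
      - 33 * realDilog (r ^ 2) + 24 * realDilog r - Real.pi ^ 2 / 6 = 6 * Real.log r ^ 2 := by
  have mr : r ∈ Set.Ioo 0 1 := ⟨by linarith, by linarith⟩
  have hp := mr.1
  have pos : ∀ n : ℕ, n ≠ 0 → 0 < 1 - r ^ n := fun n hn => (one_sub_mem_Ioo (pow_mem_Ioo mr hn)).1
  have p1 : 0 < 1 - r := sub_pos.2 mr.2
  have p2 := pos 2 two_ne_zero
  have p3 := pos 3 three_ne_zero
  have p4 := pos 4 four_ne_zero
  have p6 := pos 6 (by norm_num)
  -- The net exponent of 1 - r^n is n c_n / 6, with c_n the ladder coefficient. The logarithmic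
  -- corrections are therefore 3 log r times -2 log r.
  have hm : (1 - r ^ 6) ^ 3 * (1 - r ^ 4) ^ 2 * (1 - r) ^ 4 * r ^ 2 =
      (1 - r ^ 3) ^ 4 * (1 - r ^ 2) ^ 11 := by
    linear_combination (1 - r) ^ 9 * (1 + r) ^ 5 * (1 + r + r ^ 2) ^ 3 * (-1 + 4 * r ^ 3 - 4 * r ^ 4 -
      4 * r ^ 6 + 4 * r ^ 7 - r ^ 10) * hr
  have hlog := congrArg Real.log hm
  rw [Real.log_mul (by positivity) (by positivity), Real.log_mul (by positivity) (by positivity),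
    Real.log_mul (by positivity) (by positivity), Real.log_mul (by positivity) (by positivity)]
    at hlog
  simp only [Real.log_pow] at hlog
  push_cast at hlog
  have h := rogersL_ladder_r hr h0 h1
  simp only [rogersL_pow] at h
  rw [rogersL] at h
  push_cast at h
  linear_combination h - 3 * Real.log r * hlog

theorem realDilog_ladder_r₂ {r : ℝ} (hr : r ^ 4 - r ^ 3 - 6 * r ^ 2 - r + 1 = 0)
    (h0 : 328543397 / 10 ^ 9 < r) (h1 : r < 328543398 / 10 ^ 9) :
    realDilog (r ^ 6) - 3 * realDilog (r ^ 4) - 8 * realDilog (r ^ 3)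
      + 21 * realDilog (r ^ 2) + 24 * realDilog r - 11 * (Real.pi ^ 2 / 6)
      = -6 * Real.log r ^ 2 := by
  have mr : r ∈ Set.Ioo 0 1 := ⟨by linarith, by linarith⟩
  have hp := mr.1
  have pos : ∀ n : ℕ, n ≠ 0 → 0 < 1 - r ^ n := fun n hn => (one_sub_mem_Ioo (pow_mem_Ioo mr hn)).1
  have p1 : 0 < 1 - r := sub_pos.2 mr.2
  have p2 := pos 2 two_ne_zero
  have p3 := pos 3 three_ne_zero
  have p4 := pos 4 four_ne_zero
  have p6 := pos 6 (by norm_num)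
  -- Again the exponents are n c_n / 6, but r² is on the other side, which reverses the sign of the
  -- log² term.
  have hm : (1 - r ^ 6) * (1 - r ^ 2) ^ 7 * (1 - r) ^ 4 =
      (1 - r ^ 3) ^ 4 * (1 - r ^ 4) ^ 2 * r ^ 2 := by
    linear_combination (1 - r) ^ 6 * (1 + r) ^ 2 * (1 + r + r ^ 2) * (1 + 4 * r ^ 3 + 4 * r ^ 4 + 4 * r
      ^ 6 + 4 * r ^ 7 + r ^ 10) * hr
  have hlog := congrArg Real.log hm
  rw [Real.log_mul (by positivity) (by positivity), Real.log_mul (by positivity) (by positivity),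
    Real.log_mul (by positivity) (by positivity), Real.log_mul (by positivity) (by positivity)]
    at hlog
  simp only [Real.log_pow] at hlog
  push_cast at hlog
  have h := rogersL_ladder_r₂ hr h0 h1
  simp only [rogersL_pow] at h
  rw [rogersL] at h
  push_cast at h
  linear_combination h - 3 * Real.log r * hlog

/-! ### The algebraic numbers r and r₂, and the conclusion. -/

theorem sqrt_thirty_three_bounds :
    57445626465380 / 10 ^ 13 < √(33 : ℝ) ∧ √(33 : ℝ) < 57445626465381 / 10 ^ 13 := by
  constructor
  · exact Real.lt_sqrt_of_sq_lt (by norm_num)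
  · exact (Real.sqrt_lt' (by norm_num)).2 (by norm_num)

theorem bounds_of_eq_sqrt {r : ℝ} (hr : r = (-1 + √33 - √(2 * (9 - √33))) / 4) :
    548230268 / 10 ^ 9 < r ∧ r < 548230269 / 10 ^ 9 := by
  obtain ⟨hl, hu⟩ := sqrt_thirty_three_bounds
  have h1 : √(2 * (9 - √33)) < 25516415711 / 10 ^ 10 :=
    (Real.sqrt_lt' (by norm_num)).2 (by linarith)
  have h2 : 25516415710 / 10 ^ 10 < √(2 * (9 - √33)) :=
    Real.lt_sqrt_of_sq_lt (by linarith)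
  constructor <;> linarith

theorem bounds_of_eq_sqrt₂ {r : ℝ} (hr : r = (1 + √33 - √(2 * (9 + √33))) / 4) :
    328543397 / 10 ^ 9 < r ∧ r < 328543398 / 10 ^ 9 := by
  obtain ⟨hl, hu⟩ := sqrt_thirty_three_bounds
  have h1 : √(2 * (9 + √33)) < 54303890555 / 10 ^ 10 :=
    (Real.sqrt_lt' (by norm_num)).2 (by linarith)
  have h2 : 54303890554 / 10 ^ 10 < √(2 * (9 + √33)) :=
    Real.lt_sqrt_of_sq_lt (by linarith)
  constructor <;> linarith

theorem sq_eq_of_eq_sqrt {r : ℝ} (hr : r = (-1 + √33 - √(2 * (9 - √33))) / 4) :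
    r ^ 2 - (-1 + √33) / 2 * r + 1 = 0 := by
  have hs : √33 ^ 2 = (33 : ℝ) := Real.sq_sqrt (by norm_num)
  have hd := Real.sq_sqrt (show 0 ≤ 2 * (9 - √33) by linarith [sqrt_thirty_three_bounds.2])
  rw [hr]
  linear_combination hd / 16 - hs / 16

theorem sq_eq_of_eq_sqrt₂ {r : ℝ} (hr : r = (1 + √33 - √(2 * (9 + √33))) / 4) :
    r ^ 2 - (1 + √33) / 2 * r + 1 = 0 := by
  have hs : √33 ^ 2 = (33 : ℝ) := Real.sq_sqrt (by norm_num)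
  have hd := Real.sq_sqrt (show 0 ≤ 2 * (9 + √33) by positivity)
  rw [hr]
  linear_combination hd / 16 - hs / 16

/-- The roots of a monic quadratic with constant term 1 are mutually inverse. -/
theorem sq_sub_mul_add_one_eq_zero_iff {r t x : ℝ} (h0 : r ≠ 0) (hr : r ^ 2 - t * r + 1 = 0) :
    x ^ 2 - t * x + 1 = 0 ↔ x = r ∨ x = r⁻¹ := by
  have ht : t = r + r⁻¹ := by
    field_simp
    linarith
  have hf : x ^ 2 - t * x + 1 = (x - r) * (x - r⁻¹) := by
    rw [ht]
    linear_combination -mul_inv_cancel₀ h0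
  rw [hf, mul_eq_zero, sub_eq_zero, sub_eq_zero]

theorem mainTheorem1 (r r₂ : ℝ)
    (hr : r = (-1 + Real.sqrt 33 - Real.sqrt (2 * (9 - Real.sqrt 33))) / 4)
    (hr₂ : r₂ = (1 + Real.sqrt 33 - Real.sqrt (2 * (9 + Real.sqrt 33))) / 4) :
    (0 < r₂ ∧ r₂ < r ∧ r < 1) ∧
    {x : ℝ | 0 < x ∧
        (x ^ 4 - x ^ 3 - 6 * x ^ 2 - x + 1) * (x ^ 4 + x ^ 3 - 6 * x ^ 2 + x + 1) = 0} =
      {r, r₂, r⁻¹, r₂⁻¹} ∧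
    3 * Li₂ ((r : ℂ) ^ 6) + 3 * Li₂ ((r : ℂ) ^ 4) - 8 * Li₂ ((r : ℂ) ^ 3)
        - 33 * Li₂ ((r : ℂ) ^ 2) + 24 * Li₂ (r : ℂ) - riemannZeta 2 =
      6 * (Real.log r : ℂ) ^ 2 ∧
    Li₂ ((r₂ : ℂ) ^ 6) - 3 * Li₂ ((r₂ : ℂ) ^ 4) - 8 * Li₂ ((r₂ : ℂ) ^ 3)
        + 21 * Li₂ ((r₂ : ℂ) ^ 2) + 24 * Li₂ (r₂ : ℂ) - 11 * riemannZeta 2 =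
      -6 * (Real.log r₂ : ℂ) ^ 2 := by
  obtain ⟨hl, hu⟩ := bounds_of_eq_sqrt hr
  obtain ⟨hl₂, hu₂⟩ := bounds_of_eq_sqrt₂ hr₂
  have hq := sq_eq_of_eq_sqrt hr
  have hq₂ := sq_eq_of_eq_sqrt₂ hr₂
  have hs : √33 ^ 2 = (33 : ℝ) := Real.sq_sqrt (by norm_num)
  have hs1 := sqrt_thirty_three_bounds.1
  have h0 : 0 < r := by linarith
  have h0₂ : 0 < r₂ := by linarith
  -- The quartic is palindromic: dividing by x² gives t² + t - 8 = 0 for t = x + 1/x, whence the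
  -- splitting over ℚ(√33).
  have f : ∀ x : ℝ, x ^ 4 + x ^ 3 - 6 * x ^ 2 + x + 1 =
      (x ^ 2 - (-1 + √33) / 2 * x + 1) * (x ^ 2 + (1 + √33) / 2 * x + 1) := fun x => by
    linear_combination x ^ 2 / 4 * hs
  have f₂ : ∀ x : ℝ, x ^ 4 - x ^ 3 - 6 * x ^ 2 - x + 1 =
      (x ^ 2 - (1 + √33) / 2 * x + 1) * (x ^ 2 + (-1 + √33) / 2 * x + 1) := fun x => by
    linear_combination x ^ 2 / 4 * hs
  refine ⟨⟨h0₂, by linarith, by linarith⟩, ?_, ?_, ?_⟩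
  · ext x
    simp only [Set.mem_ofPred_eq, Set.mem_insert_iff, Set.mem_singleton_iff]
    -- The two remaining quadratic factors have positive coefficients, hence no positive roots.
    have hpos : 0 < x → x ^ 2 + (1 + √33) / 2 * x + 1 ≠ 0 := fun hx => by positivity
    have hpos₂ : 0 < x → x ^ 2 + (-1 + √33) / 2 * x + 1 ≠ 0 := fun hx => by
      have : 0 < -1 + √33 := by linarith
      positivity
    rw [f, f₂, mul_eq_zero, mul_eq_zero, mul_eq_zero, sq_sub_mul_add_one_eq_zero_iff h0.ne' hq,
      sq_sub_mul_add_one_eq_zero_iff h0₂.ne' hq₂]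
    constructor
    · rintro ⟨hx, h⟩
      have := hpos hx
      have := hpos₂ hx
      tauto
    · rintro (rfl | rfl | rfl | rfl) <;> refine ⟨by positivity, by tauto⟩
  · have h := realDilog_ladder_r (by rw [f, hq, zero_mul]) hl hu
    rw [riemannZeta_two]
    simp only [← Complex.ofReal_pow, Li₂_ofReal]
    exact_mod_cast congrArg Complex.ofReal h
  · have h := realDilog_ladder_r₂ (by rw [f₂, hq₂, zero_mul]) hl₂ hu₂
    rw [riemannZeta_two]
    simp only [← Complex.ofReal_pow, Li₂_ofReal]
    exact_mod_cast congrArg Complex.ofReal h
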